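/- Let $\mathcal{L}\colon[0,\infty)\to\mathbb{R}$ satisfy Condition L: there are $s_0,a,\lambda_0>0$ such that $\mathcal{L}\in C^0([0,\infty))\cap C^1((0,s_0))$, $\mathcal{L}$ is positive, bounded and nondecreasing on $(0,\infty)$, and $$\mathcal{L}(s)\le(1+a\lambda)\,\mathcal{L}(s^{1+\lambda})\qquad\text{for all } s\in(0,s_0),\ \lambda\in(0,\lambda_0).$$ Let $n\in\mathbb{N}$, $n\ge1$, let $r\in[1,\infty)$ and $q\in\bigl(0,\frac{rn}{(n-r)_+}\bigr)$ be real, where $\frac{rn}{(n-r)_+}=\infty$ if $n\le r$, and set $\nu=\frac1q-\frac{n-r}{rn}$. Then for every $\varepsilon>0$ there is $C=C(\varepsilon,n,q,r,\mathcal{L})>0$ such that every function $\varphi\in W^{1,r}(\mathbb{R}^n)\setminus\{0\}$ with $\varphi\ge0$ almost everywhere and $K:=\int_{\mathbb{R}^n}\mathcal{L}(\varphi(x))\,dx<\infty$ belongs to $L^q(\mathbb{R}^n)$ and satisfies $$\|\varphi\|_{L^q(\mathbb{R}^n)}\le C\,\bigl(1+(1+K^\varepsilon)K^\nu\bigr)\,\|\nabla\varphi\|_{L^r(\mathbb{R}^n)}\,\Bigl(\mathcal{L}\bigl(\|\nabla\varphi\|_{L^r(\mathbb{R}^n)}^2\bigr)\Bigr)^{-\nu}.$$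 Here $\|\varphi\|_{L^q(\mathbb{R}^n)}=\bigl(\int_{\mathbb{R}^n}|\varphi|^q\,dx\bigr)^{1/q}$, also for $0<q<1$, and $\nabla\varphi$ is the weak gradient. -/

import Mathlib

open MeasureTheory Set
open scoped ContDiff

/-- Condition L for a function `L` on `[0,∞)` (values at negative arguments are irrelevant):
for some `s₀ > 0`, `L ∈ C⁰([0,∞)) ∩ C¹((0,s₀))` is positive, bounded and nondecreasing on
`(0,∞)`, and there are `a, lam₀ > 0` such that `L(s) ≤ (1 + a lam) L(s ^ (1 + lam))` for all
`s ∈ (0,s₀)` and `lam ∈ (0,lam₀)`. -/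
def ConditionL (L : ℝ → ℝ) : Prop :=
  ∃ s₀ : ℝ, 0 < s₀ ∧
    ContinuousOn L (Ici 0) ∧
    ContDiffOn ℝ 1 L (Ioo 0 s₀) ∧
    (∀ s ∈ Ioi (0 : ℝ), 0 < L s) ∧
    (∃ M : ℝ, ∀ s ∈ Ioi (0 : ℝ), L s ≤ M) ∧
    MonotoneOn L (Ioi 0) ∧
    ∃ a lam₀ : ℝ, 0 < a ∧ 0 < lam₀ ∧
      ∀ s ∈ Ioo 0 s₀, ∀ lam ∈ Ioo 0 lam₀, L s ≤ (1 + a * lam) * L (s ^ (1 + lam))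

/-- `g` is a weak (distributional) gradient of `φ` on `ℝⁿ`: both are locally integrable and
`∫ φ ∂ᵢη = - ∫ gᵢ η` for every test function `η ∈ C_c^∞(ℝⁿ)` and every coordinate `i`.
Such a `g` is unique up to null sets. -/
def HasWeakGradient {n : ℕ} (φ : EuclideanSpace ℝ (Fin n) → ℝ)
    (g : EuclideanSpace ℝ (Fin n) → EuclideanSpace ℝ (Fin n)) : Prop :=
  LocallyIntegrable φ volume ∧ LocallyIntegrable g volume ∧
    ∀ η : EuclideanSpace ℝ (Fin n) → ℝ, ContDiff ℝ ∞ η → HasCompactSupport η →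
      ∀ i : Fin n,
        ∫ x, φ x * fderiv ℝ η x (EuclideanSpace.single i (1 : ℝ)) = - ∫ x, g x i * η x

/-- `φ ∈ W^{1,r}(ℝⁿ)`: `φ ∈ L^r`, and `φ` has a weak gradient in `L^r`. -/
def MemW1 {n : ℕ} (r : ℝ) (φ : EuclideanSpace ℝ (Fin n) → ℝ) : Prop :=
  MemLp φ (ENNReal.ofReal r) volume ∧
    ∃ g : EuclideanSpace ℝ (Fin n) → EuclideanSpace ℝ (Fin n),
      HasWeakGradient φ g ∧ MemLp g (ENNReal.ofReal r) volume

/-!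
Fix `φ ≥ 0` in `W^{1,r}` with `K = ∫ L(φ) < ∞` and `G = ‖∇φ‖_r`, and split `φ` at a level
comparable to `s > 0`.

*Above the level.* By Markov's inequality `{φ ≥ s}` has measure at most `K / L(s)`. For functions
vanishing off a set of measure `m`, the Gagliardo-Nirenberg-Sobolev inequality and Hölder's
inequality give `‖u‖_q ≤ C m ^ ν ‖∇u‖_r`; hence the part of `φ` above the level is bounded in `L^q`
by `C (K / L(s)) ^ ν G` (`exists_eLpNorm_comp_le_measure_rpow_mul`). The inequality for `C¹`
compactly supported functions is transferred to `W^{1,r}` by mollifying, cutting off, composing with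
a `C¹` soft threshold, and applying Fatou's lemma twice. The measures of the level sets pass to
the limit because almost everywhere convergence implies convergence in measure on the support of
the cutoff.

*Below the level.* Condition L makes `L` slowly varying at `0`: iterating it gives
`L(s) ≤ C (s / t) ^ α L(t)` for `0 < t ≤ s` and any `α > 0` (`ConditionL.le_rpow_mul`). With `α = q`
this bounds `min(φ, s) ^ q` by a multiple of `s ^ q L(φ) / L(s)`, so that
`‖min(φ, s)‖_q ≤ C s (K / L(s)) ^ (1 / q)` (`ConditionL.exists_eLpNorm_min_le`).

*Choice of the level.* The two bounds balance at `s = G (K / L(G²)) ^ (ν - 1 / q)`, up to replacing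
`L(s)` by `L(G²)`. Slow variation with a small exponent `α` shows that this replacement costs a
factor `1 + K ^ δ` with `|δ|` as small as desired, which is absorbed by the `1 + (1 + K ^ ε) K ^ ν`
in the estimate (`ConditionL.exists_level`).
-/

open scoped ENNReal NNReal Convolution
open Filter Topology

/-! ### Slow variation of `L` under Condition L -/

/-- In the variable `x = -log s`, Condition L says that `L` loses at most the factor
`1 + a (y - x) / x` from `x` to a nearby `y`. For `x ≥ a / α` this is at most `exp (α (y - x))`, and
such bounds chain. -/
lemma ConditionL.exp_growth {L : ℝ → ℝ} (hL : ConditionL L) {α : ℝ} (hα : 0 < α) :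
    ∃ X : ℝ, 0 < X ∧ ∀ x y : ℝ, X ≤ x → x ≤ y →
      L (Real.exp (-x)) ≤ Real.exp (α * (y - x)) * L (Real.exp (-y)) := by
  obtain ⟨s₀, hs₀, -, -, hpos, -, -, a, l₀, ha, hl₀, hcond⟩ := hL
  obtain ⟨X, hX0, hXs, hXa⟩ : ∃ X : ℝ, 0 < X ∧ Real.exp (-X) < s₀ ∧ a ≤ α * X := by
    refine ⟨max 1 (max (-Real.log s₀ + 1) (a / α)), by positivity, ?_, ?_⟩
    · rw [← Real.lt_log_iff_exp_lt hs₀]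
      have : -Real.log s₀ + 1 ≤ max 1 (max (-Real.log s₀ + 1) (a / α)) :=
        (le_max_left _ _).trans (le_max_right _ _)
      linarith
    · have : a / α ≤ max 1 (max (-Real.log s₀ + 1) (a / α)) :=
        (le_max_right _ _).trans (le_max_right _ _)
      rwa [div_le_iff₀' hα] at this
  refine ⟨X, hX0, ?_⟩
  set δ : ℝ := l₀ * X / 2 with hδ
  have hδ0 : 0 < δ := by positivity
  have short : ∀ x y : ℝ, X ≤ x → x ≤ y → y ≤ x + δ →
      L (Real.exp (-x)) ≤ Real.exp (α * (y - x)) * L (Real.exp (-y)) := by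
    intro x y hx hxy hy
    rcases hxy.eq_or_lt with rfl | hlt
    · simp
    have hx0 : 0 < x := hX0.trans_le hx
    have h1 : (y - x) / x ∈ Ioo 0 l₀ := by
      refine ⟨div_pos (by linarith) hx0, ?_⟩
      rw [div_lt_iff₀ hx0]
      nlinarith
    have h2 : Real.exp (-x) ∈ Ioo 0 s₀ :=
      ⟨Real.exp_pos _, (Real.exp_le_exp.2 (by linarith)).trans_lt hXs⟩
    have h3 := hcond _ h2 _ h1
    have h4 : Real.exp (-x) ^ (1 + (y - x) / x) = Real.exp (-y) := by
      rw [← Real.exp_mul]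
      congr 1
      field_simp
      ring
    rw [h4] at h3
    refine h3.trans (mul_le_mul_of_nonneg_right ?_ (hpos _ (Real.exp_pos _)).le)
    have h5 : a * ((y - x) / x) ≤ α * (y - x) := by
      have : a ≤ α * x := hXa.trans (by gcongr)
      rw [mul_div_assoc', div_le_iff₀ hx0]
      nlinarith [mul_le_mul_of_nonneg_right this (sub_nonneg.2 hxy)]
    calc 1 + a * ((y - x) / x) = a * ((y - x) / x) + 1 := by ring
      _ ≤ Real.exp (a * ((y - x) / x)) := Real.add_one_le_exp _
      _ ≤ _ := Real.exp_le_exp.2 h5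
  have long : ∀ N : ℕ, ∀ x y : ℝ, X ≤ x → x ≤ y → y ≤ x + N * δ →
      L (Real.exp (-x)) ≤ Real.exp (α * (y - x)) * L (Real.exp (-y)) := by
    intro N
    induction N with
    | zero => exact fun x y hx hxy hy => short x y hx hxy (by simp at hy; linarith)
    | succ N ih =>
      intro x y hx hxy hy
      rcases le_total y (x + δ) with h | h
      · exact short x y hx hxy h
      · have h1 := short x (x + δ) hx (by linarith) le_rfl
        have h2 := ih (x + δ) y (by linarith) h (by push_cast at hy; linarith)
        calc L (Real.exp (-x)) ≤ _ := h1
          _ ≤ Real.exp (α * (x + δ - x)) *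
              (Real.exp (α * (y - (x + δ))) * L (Real.exp (-y))) := by gcongr
          _ = _ := by
            rw [← mul_assoc, ← Real.exp_add]
            ring_nf
  intro x y hx hxy
  obtain ⟨N, hN⟩ := exists_nat_ge ((y - x) / δ)
  exact long N x y hx hxy (by rw [div_le_iff₀ hδ0] at hN; linarith)

/-- `L` varies more slowly than any power, in the form of Potter's bound. It holds for all
`0 < t ≤ s`, because `L` is bounded and bounded away from `0` off any neighbourhood of `0`. -/
lemma ConditionL.le_rpow_mul {L : ℝ → ℝ} (hL : ConditionL L) {α : ℝ} (hα : 0 < α) :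
    ∃ C : ℝ, 1 ≤ C ∧ ∀ t s : ℝ, 0 < t → t ≤ s → L s ≤ C * (s / t) ^ α * L t := by
  obtain ⟨X, -, hgrow⟩ := hL.exp_growth hα
  obtain ⟨-, -, -, -, hpos, ⟨M, hM⟩, hmono, -⟩ := hL
  have small : ∀ t s : ℝ, 0 < t → t ≤ s → s ≤ Real.exp (-X) → L s ≤ (s / t) ^ α * L t := by
    intro t s ht hts hs
    have hs0 := ht.trans_le hts
    have h := hgrow (-Real.log s) (-Real.log t)
      (by rw [← Real.log_le_iff_le_exp hs0] at hs; linarith)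
      (by have := Real.log_le_log ht hts; linarith)
    rw [neg_neg, neg_neg, Real.exp_log ht, Real.exp_log hs0] at h
    convert h using 2
    rw [Real.rpow_def_of_pos (by positivity), Real.log_div hs0.ne' ht.ne']
    ring_nf
  set s₂ := Real.exp (-X)
  have hs₂ : 0 < s₂ := Real.exp_pos _
  have hL₂ := hpos s₂ hs₂
  have hC : 1 ≤ M / L s₂ := by rw [one_le_div hL₂]; exact hM _ hs₂
  refine ⟨M / L s₂, hC, fun t s ht hts => ?_⟩
  have hs0 := ht.trans_le hts
  have hLt := hpos t ht
  have h1 : 1 ≤ (s / t) ^ α := Real.one_le_rpow (by rwa [one_le_div ht]) hα.le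
  rcases le_total s s₂ with hs | hs
  · calc L s ≤ (s / t) ^ α * L t := small t s ht hts hs
      _ ≤ _ := by gcongr; exact le_mul_of_one_le_left (by positivity) hC
  · have hLs : L s ≤ M / L s₂ * L s₂ := by
      rw [div_mul_cancel₀ _ hL₂.ne']; exact hM _ hs0
    refine hLs.trans ?_
    rw [mul_assoc]
    gcongr
    rcases le_total t s₂ with h | h
    · refine (small t s₂ ht h le_rfl).trans ?_
      gcongr
    · exact (hmono hs₂ ht h).trans (le_mul_of_one_le_left hLt.le h1)

/-! ### Sobolev inequality for smooth functions vanishing off a set of given measure -/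

lemma eLpNorm_le_of_eq_zero_off {α F : Type*} [MeasurableSpace α] {μ : Measure α}
    [NormedAddCommGroup F] {f : α → F} (hf : AEStronglyMeasurable f μ) {S : Set α}
    (hS : ∀ x ∉ S, f x = 0) {p q : ℝ≥0∞} (hpq : p ≤ q) :
    eLpNorm f p μ ≤ eLpNorm f q μ * μ S ^ (1 / p.toReal - 1 / q.toReal) := by
  have hsub : Function.support f ⊆ S := fun x hx => by
    by_contra h
    exact hx (hS x h)
  rw [← eLpNorm_restrict_eq_of_support_subset (p := p) hsub,
    ← eLpNorm_restrict_eq_of_support_subset (p := q) hsub]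
  have h := eLpNorm_le_eLpNorm_mul_rpow_measure_univ (μ := μ.restrict S) hpq hf.restrict
  rwa [Measure.restrict_apply_univ] at h

/-- The one-dimensional endpoint, which the Gagliardo-Nirenberg-Sobolev inequality in Mathlib does
not include; it is the fundamental theorem of calculus. -/
lemma eLpNorm_top_le_eLpNorm_fderiv_one {u : EuclideanSpace ℝ (Fin 1) → ℝ}
    (hu : ContDiff ℝ 1 u) (hsupp : HasCompactSupport u) :
    eLpNorm u ∞ volume ≤ eLpNorm (fderiv ℝ u) 1 volume := by
  let e : ℝ ≃ₗᵢ[ℝ] EuclideanSpace ℝ (Fin 1) := (OrthonormalBasis.singleton (Fin 1) ℝ).repr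
  have he : MeasurePreserving e volume volume := e.measurePreserving
  have hue : ContDiff ℝ 1 (u ∘ e) := hu.comp e.contDiff
  have hsupp' : HasCompactSupport (u ∘ e) := hsupp.comp_homeomorph e.toHomeomorph
  have hderiv : ∀ t, ‖deriv (u ∘ e) t‖ₑ ≤ ‖fderiv ℝ u (e t)‖ₑ := by
    intro t
    have h1 : HasDerivAt e (e 1) t := by
      simpa using e.toContinuousLinearEquiv.toContinuousLinearMap.hasDerivAt (x := t)
    have h2 := ((hu.differentiable one_ne_zero (e t)).hasFDerivAt.comp_hasDerivAt t h1).deriv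
    rw [h2]
    have h3 := (fderiv ℝ u (e t)).le_opNorm (e 1)
    rw [e.norm_map, norm_one, mul_one] at h3
    exact enorm_le_iff_norm_le.2 h3
  have key : ∀ x, ‖u x‖ₑ ≤ eLpNorm (fderiv ℝ u) 1 volume := by
    intro x
    have h1 := HasCompactSupport.enorm_le_lintegral_Ici_deriv hue hsupp' (e.symm x)
    simp only [Function.comp_apply, e.apply_symm_apply] at h1
    refine h1.trans ((setLIntegral_le_lintegral _ _).trans ((lintegral_mono hderiv).trans ?_))
    rw [eLpNorm_one_eq_lintegral_enorm,
      he.lintegral_comp (f := fun y => ‖fderiv ℝ u y‖ₑ)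
        (hu.continuous_fderiv one_ne_zero).enorm.measurable]
  rw [eLpNorm_exponent_top]
  exact essSup_le_of_ae_le _ (Filter.Eventually.of_forall key)

/-- Sobolev inequality with the volume of the support: Hölder's inequality on both sides of the
Gagliardo-Nirenberg-Sobolev inequality, for a suitable exponent below the dimension. -/
theorem eLpNorm_le_measure_rpow_mul_eLpNorm_fderiv {n : ℕ} (hn : 1 ≤ n) {r q ν : ℝ} (hr : 1 ≤ r)
    (hq : 0 < q) (hqr : r < n → q < r * n / (n - r)) (hν : ν = 1 / q - (n - r) / (r * n)) :
    ∃ C : ℝ≥0, ∀ u : EuclideanSpace ℝ (Fin n) → ℝ, ContDiff ℝ 1 u → HasCompactSupport u →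
      ∀ S : Set (EuclideanSpace ℝ (Fin n)), (∀ x ∉ S, u x = 0) → (∀ x ∉ S, fderiv ℝ u x = 0) →
        eLpNorm u (ENNReal.ofReal q) volume ≤
          C * volume S ^ ν * eLpNorm (fderiv ℝ u) (ENNReal.ofReal r) volume := by
  have hr0 : 0 < r := by linarith
  have hn0 : (0 : ℝ) < n := by exact_mod_cast hn
  have hν' : ν = 1 / q - 1 / r + 1 / n := by
    rw [hν]; field_simp; ring
  -- It suffices to compare `L^{p'}` with `L^p`, where `p ≤ r`, `q ≤ p'` and `1/p' = 1/p - 1/n`.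
  -- For `p' = ∞`, the convention `1 / p'.toReal = 0` is the intended value.
  suffices H : ∃ (p : ℝ) (p' : ℝ≥0∞) (C : ℝ≥0), 1 ≤ p ∧ p ≤ r ∧ ENNReal.ofReal q ≤ p' ∧
      1 / p'.toReal = 1 / p - 1 / n ∧
      ∀ u : EuclideanSpace ℝ (Fin n) → ℝ, ContDiff ℝ 1 u → HasCompactSupport u →
        eLpNorm u p' volume ≤ C * eLpNorm (fderiv ℝ u) (ENNReal.ofReal p) volume by
    obtain ⟨p, p', C, hp1, hpr, hqp', hpp', hC⟩ := H
    refine ⟨C, fun u hu hsupp S hS hS' => ?_⟩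
    have hp0 : 0 < p := by linarith
    have h1 := eLpNorm_le_of_eq_zero_off (μ := volume) hu.continuous.aestronglyMeasurable hS hqp'
    have h2 := eLpNorm_le_of_eq_zero_off (μ := volume)
      (hu.continuous_fderiv one_ne_zero).aestronglyMeasurable hS' (ENNReal.ofReal_le_ofReal hpr)
    rw [ENNReal.toReal_ofReal hq.le] at h1
    rw [ENNReal.toReal_ofReal hp0.le, ENNReal.toReal_ofReal hr0.le] at h2
    have e1 : 0 ≤ 1 / q - 1 / p'.toReal := by
      rcases eq_or_ne p' ∞ with rfl | htop
      · simpa using hq.le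
      · rw [sub_nonneg]
        exact one_div_le_one_div_of_le hq ((ENNReal.ofReal_le_iff_le_toReal htop).1 hqp')
    have e2 : 0 ≤ 1 / p - 1 / r := sub_nonneg.2 (one_div_le_one_div_of_le hp0 hpr)
    have e3 : ν = (1 / p - 1 / r) + (1 / q - 1 / p'.toReal) := by rw [hν', hpp']; ring
    calc eLpNorm u (ENNReal.ofReal q) volume
        ≤ eLpNorm u p' volume * volume S ^ (1 / q - 1 / p'.toReal) := h1
      _ ≤ C * (eLpNorm (fderiv ℝ u) (ENNReal.ofReal r) volume * volume S ^ (1 / p - 1 / r)) *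
          volume S ^ (1 / q - 1 / p'.toReal) := by
        gcongr
        exact (hC u hu hsupp).trans (by gcongr)
      _ = _ := by
        rw [e3, ENNReal.rpow_add_of_nonneg _ _ e2 e1]
        ring
  rcases hn.eq_or_lt with rfl | hn2
  · exact ⟨1, ∞, 1, le_rfl, hr, le_top, by simp, fun u hu hsupp => by
      simpa using eLpNorm_top_le_eLpNorm_fderiv_one hu hsupp⟩
  · have hn2' : (1 : ℝ) < n := by exact_mod_cast hn2
    obtain ⟨p, hp1, hpr, hpn, hpq⟩ : ∃ p : ℝ, 1 ≤ p ∧ p ≤ r ∧ p < n ∧ 1 / p - 1 / n ≤ 1 / q := by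
      rcases lt_or_ge r n with hrn | hrn
      · refine ⟨r, hr, le_rfl, hrn, ?_⟩
        have h1 := hqr hrn
        rw [lt_div_iff₀ (by linarith)] at h1
        rw [div_sub_div _ _ hr0.ne' hn0.ne', div_le_div_iff₀ (by positivity) hq]
        linarith
      -- The exponent `p` with `1 / p = 1 / n + 1 / q`, raised to `1` if it is smaller.
      · have h2 : (0 : ℝ) < 1 / n + 1 / q := by positivity
        have h3 : (1 / n + 1 / q)⁻¹ < (n : ℝ) := by
          rw [inv_lt_comm₀ h2 hn0, ← one_div]
          linarith [one_div_pos.2 hq]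
        have h4 : max 1 (1 / n + 1 / q)⁻¹ < (n : ℝ) := max_lt hn2' h3
        refine ⟨max 1 (1 / n + 1 / q)⁻¹, le_max_left _ _, (h4.trans_le hrn).le, h4, ?_⟩
        have h5 : 1 / max 1 (1 / (n : ℝ) + 1 / q)⁻¹ ≤ 1 / (1 / (n : ℝ) + 1 / q)⁻¹ :=
          one_div_le_one_div_of_le (by positivity) (le_max_right _ _)
        rw [one_div (_⁻¹), inv_inv] at h5
        linarith
    have hp0 : 0 < p := by linarith
    have hsub : 0 < 1 / p - 1 / n := sub_pos.2 (one_div_lt_one_div_of_lt hp0 hpn)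
    refine ⟨p, ENNReal.ofReal (1 / p - 1 / n)⁻¹,
      SNormLESNormFDerivOfEqConst ℝ
        (volume : Measure (EuclideanSpace ℝ (Fin n))) p.toNNReal, hp1, hpr, ?_, ?_,
      fun u hu hsupp => ?_⟩
    · apply ENNReal.ofReal_le_ofReal
      rw [le_inv_comm₀ hq hsub, ← one_div]
      exact hpq
    · rw [ENNReal.toReal_ofReal (by positivity), one_div, inv_inv]
    · refine (eLpNorm_le_eLpNorm_fderiv_of_eq volume hu hsupp (p := p.toNNReal)
        (p' := (1 / p - 1 / n)⁻¹.toNNReal) ?_ ?_ ?_).trans (le_of_eq ?_)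
      · rwa [Real.one_le_toNNReal]
      · simpa using Nat.pos_of_ne_zero (by omega)
      · rw [Real.coe_toNNReal _ (by positivity), NNReal.coe_inv, Real.coe_toNNReal _ hp0.le,
          inv_inv]
        simp
      · rw [Real.coe_toNNReal _ hp0.le]; rfl

/-! ### Mollification and weak gradients -/

/-- Mollification does not increase the `L^p` norm: Jensen's inequality for the probability measure
whose density is the mollifier, followed by Tonelli's theorem. -/
theorem eLpNorm_normed_convolution_le {G F : Type*} [NormedAddCommGroup G] [NormedSpace ℝ G]
    [FiniteDimensional ℝ G] [MeasurableSpace G] [BorelSpace G] {μ : Measure G} [μ.IsAddHaarMeasure]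
    [NormedAddCommGroup F] [NormedSpace ℝ F] (ρ : ContDiffBump (0 : G)) {f : G → F}
    (hf : AEStronglyMeasurable f μ) {p : ℝ} (hp : 1 ≤ p) :
    eLpNorm (ρ.normed μ ⋆[ContinuousLinearMap.lsmul ℝ ℝ, μ] f) (ENNReal.ofReal p) μ ≤
      eLpNorm f (ENNReal.ofReal p) μ := by
  have hp0 : 0 < p := by linarith
  wlog hfm : StronglyMeasurable f generalizing f
  · rw [convolution_congr _ Filter.EventuallyEq.rfl hf.ae_eq_mk, eLpNorm_congr_ae hf.ae_eq_mk]
    exact this hf.stronglyMeasurable_mk.aestronglyMeasurable hf.stronglyMeasurable_mk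
  -- `m` is the probability measure with the mollifier as density.
  set w : G → ℝ≥0∞ := fun t => ENNReal.ofReal (ρ.normed μ t)
  have hwm : Measurable w := ρ.continuous_normed.measurable.ennreal_ofReal
  set m : Measure G := μ.withDensity w with hm
  have hprob : IsProbabilityMeasure m := by
    refine ⟨?_⟩
    rw [hm, withDensity_apply _ MeasurableSet.univ, Measure.restrict_univ,
      ← ofReal_integral_eq_lintegral_ofReal ρ.integrable_normed
        (Filter.Eventually.of_forall fun x => ρ.nonneg_normed x), ρ.integral_normed,
      ENNReal.ofReal_one]
  have hpt : ∀ x, ‖(ρ.normed μ ⋆[ContinuousLinearMap.lsmul ℝ ℝ, μ] f) x‖ₑ ^ p ≤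
      ∫⁻ t, ‖f (x - t)‖ₑ ^ p ∂m := by
    intro x
    have hfx : StronglyMeasurable fun t => f (x - t) :=
      hfm.comp_measurable (measurable_const.sub measurable_id)
    have h1 : ‖(ρ.normed μ ⋆[ContinuousLinearMap.lsmul ℝ ℝ, μ] f) x‖ₑ ≤
        ∫⁻ t, ‖f (x - t)‖ₑ ∂m := by
      rw [hm, lintegral_withDensity_eq_lintegral_mul _ hwm hfx.enorm, convolution_lsmul]
      refine (enorm_integral_le_lintegral_enorm _).trans (lintegral_mono fun t => ?_)
      rw [enorm_smul, Real.enorm_of_nonneg (ρ.nonneg_normed t)]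
      rfl
    have h2 := eLpNorm'_le_eLpNorm'_of_exponent_le one_pos hp m hfx.aestronglyMeasurable
    simp only [eLpNorm'_eq_lintegral_enorm, ENNReal.rpow_one, div_one] at h2
    calc _ ≤ ((∫⁻ t, ‖f (x - t)‖ₑ ^ p ∂m) ^ (1 / p)) ^ p := by gcongr; exact h1.trans h2
      _ = _ := by rw [← ENNReal.rpow_mul, one_div_mul_cancel hp0.ne', ENNReal.rpow_one]
  rw [eLpNorm_eq_lintegral_rpow_enorm_toReal (by simpa using hp0) ENNReal.ofReal_ne_top,
    eLpNorm_eq_lintegral_rpow_enorm_toReal (by simpa using hp0) ENNReal.ofReal_ne_top,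
    ENNReal.toReal_ofReal hp0.le]
  refine ENNReal.rpow_le_rpow ?_ (by positivity)
  calc ∫⁻ x, ‖(ρ.normed μ ⋆[ContinuousLinearMap.lsmul ℝ ℝ, μ] f) x‖ₑ ^ p ∂μ
      ≤ ∫⁻ x, ∫⁻ t, ‖f (x - t)‖ₑ ^ p ∂m ∂μ := lintegral_mono hpt
    _ = ∫⁻ t, ∫⁻ x, ‖f (x - t)‖ₑ ^ p ∂μ ∂m := by
      apply lintegral_lintegral_swap
      exact ((hfm.comp_measurable (measurable_fst.sub measurable_snd)).enorm.pow_const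
        p).aemeasurable
    _ = ∫⁻ _, ∫⁻ x, ‖f x‖ₑ ^ p ∂μ ∂m := by
      congr 1 with t
      exact lintegral_sub_right_eq_self (fun x => ‖f x‖ₑ ^ p) t
    _ = ∫⁻ x, ‖f x‖ₑ ^ p ∂μ := by simp

section Mollification

variable {n : ℕ} {φ : EuclideanSpace ℝ (Fin n) → ℝ}
  {g : EuclideanSpace ℝ (Fin n) → EuclideanSpace ℝ (Fin n)}

lemma contDiff_normed_convolution (ρ : ContDiffBump (0 : EuclideanSpace ℝ (Fin n)))
    (hφ : LocallyIntegrable φ volume) :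
    ContDiff ℝ 1 (ρ.normed volume ⋆[ContinuousLinearMap.lsmul ℝ ℝ, volume] φ) :=
  ρ.hasCompactSupport_normed.contDiff_convolution_left _ ρ.contDiff_normed hφ

/-- The gradient of a mollified function is the mollified weak gradient: test the definition of the
weak gradient against the reflected and translated mollifier. -/
theorem HasWeakGradient.fderiv_normed_convolution (h : HasWeakGradient φ g)
    (ρ : ContDiffBump (0 : EuclideanSpace ℝ (Fin n))) (x : EuclideanSpace ℝ (Fin n)) :
    fderiv ℝ (ρ.normed volume ⋆[ContinuousLinearMap.lsmul ℝ ℝ, volume] φ) x =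
      innerSL ℝ ((ρ.normed volume ⋆[ContinuousLinearMap.lsmul ℝ ℝ, volume] g) x) := by
  obtain ⟨hφ, hg, hint⟩ := h
  set w := ρ.normed (volume : Measure (EuclideanSpace ℝ (Fin n)))
  have hwc : HasCompactSupport w := ρ.hasCompactSupport_normed
  have hws : ContDiff ℝ ∞ w := ρ.contDiff_normed
  have hw1 : ContDiff ℝ 1 w := ρ.contDiff_normed
  have hderiv := hwc.hasFDerivAt_convolution_right (ContinuousLinearMap.lsmul ℝ ℝ).flip hφ hw1 x
  rw [convolution_flip] at hderiv
  have hexists : ConvolutionExistsAt w g x (ContinuousLinearMap.lsmul ℝ ℝ) volume :=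
    hwc.convolutionExists_left _ hw1.continuous hg x
  have hcoord : ∀ i, fderiv ℝ (w ⋆[ContinuousLinearMap.lsmul ℝ ℝ, volume] φ) x
      (EuclideanSpace.single i 1) =
      ((w ⋆[ContinuousLinearMap.lsmul ℝ ℝ, volume] g) x) i := by
    intro i
    set η : EuclideanSpace ℝ (Fin n) → ℝ := fun t => w (x - t) with hη
    have hηs : ContDiff ℝ ∞ η := hws.comp (contDiff_const.sub contDiff_id)
    have hηc : HasCompactSupport η := hwc.comp_homeomorph (Homeomorph.subLeft x)
    have hηd : ∀ t v, fderiv ℝ η t v = -fderiv ℝ w (x - t) v := by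
      intro t v
      have h1 : HasFDerivAt (fun t => x - t)
          (-(ContinuousLinearMap.id ℝ (EuclideanSpace ℝ (Fin n)))) t :=
        (hasFDerivAt_id t).const_sub x
      have h2 := ((hw1.differentiable one_ne_zero (x - t)).hasFDerivAt.comp t h1).fderiv
      have h3 : fderiv ℝ η t = _ := h2
      rw [h3]
      simp
    have h1 := hint η hηs hηc i
    rw [hderiv.fderiv, convolution_precompR_apply _ hφ (hwc.fderiv ℝ)
      (hw1.continuous_fderiv one_ne_zero), convolution_def]
    have h2 : ((w ⋆[ContinuousLinearMap.lsmul ℝ ℝ, volume] g) x) i = ∫ t, g t i * η t := by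
      rw [convolution_eq_swap]
      have h3 := (EuclideanSpace.proj (𝕜 := ℝ) i).integral_comp_comm hexists.integrable_swap
      simp only [ContinuousLinearMap.lsmul_apply] at h3 ⊢
      refine h3.symm.trans ?_
      congr 1 with t
      simp [hη, mul_comm]
    rw [h2, ← neg_eq_iff_eq_neg.2 h1, ← integral_neg]
    congr 1 with t
    rw [hηd]
    simp [mul_comm]
  have hcoe : (fderiv ℝ (w ⋆[ContinuousLinearMap.lsmul ℝ ℝ, volume] φ) x).toLinearMap =
      (innerSL ℝ ((w ⋆[ContinuousLinearMap.lsmul ℝ ℝ, volume] g) x)).toLinearMap := by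
    refine (EuclideanSpace.basisFun (Fin n) ℝ).toBasis.ext fun i => ?_
    simpa [EuclideanSpace.inner_single_right] using hcoord i
  exact ContinuousLinearMap.coe_injective hcoe

theorem HasWeakGradient.ae_eq {g' : EuclideanSpace ℝ (Fin n) → EuclideanSpace ℝ (Fin n)}
    (h : HasWeakGradient φ g) (h' : HasWeakGradient φ g') : g =ᵐ[volume] g' := by
  have hi : ∀ i : Fin n, ∀ᵐ x, g x i = g' x i := by
    intro i
    refine ae_eq_of_integral_contDiff_smul_eq (μ := volume) ?_ ?_ fun η hη hηc => ?_
    · exact fun x => (h.2.1 x).imp fun s hs =>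
        ⟨hs.1, (EuclideanSpace.proj (𝕜 := ℝ) i).integrable_comp hs.2⟩
    · exact fun x => (h'.2.1 x).imp fun s hs =>
        ⟨hs.1, (EuclideanSpace.proj (𝕜 := ℝ) i).integrable_comp hs.2⟩
    · have := neg_inj.1 ((h.2.2 η hη hηc i).symm.trans (h'.2.2 η hη hηc i))
      simpa only [smul_eq_mul, mul_comm] using this
  filter_upwards [ae_all_iff.2 hi] with x hx
  ext i
  exact hx i

end Mollification

/-! ### Sobolev inequality for truncated `W^{1,r}` functions -/

/-- A nonnegative `C¹` substitute for `t ↦ max (t - s) 0`, obtained by integrating a piecewise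
linear ramp from `0` to `1`. Being `C¹`, it preserves `C¹` functions under composition. -/
lemma exists_contDiff_soft_threshold {s : ℝ} (hs : 0 < s) :
    ∃ h : ℝ → ℝ, ContDiff ℝ 1 h ∧ (∀ t ≤ s, h t = 0) ∧ (∀ t ≤ s, deriv h t = 0) ∧
      (∀ t, ‖deriv h t‖ ≤ 1) ∧ (∀ t, 0 ≤ h t) ∧ ∀ t, t - 2 * s ≤ h t := by
  set k : ℝ → ℝ := fun t => max 0 (min 1 (t / s - 1)) with hk
  have hkc : Continuous k := by fun_prop
  have hk0 : ∀ t, 0 ≤ k t := fun t => le_max_left _ _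
  have hk1 : ∀ t, k t ≤ 1 := fun t => max_le zero_le_one (min_le_left _ _)
  have hks : ∀ t ≤ s, k t = 0 := fun t ht => by
    have : t / s ≤ 1 := by rwa [div_le_one hs]
    exact max_eq_left ((min_le_right _ _).trans (by linarith))
  have hk2s : ∀ t, 2 * s ≤ t → k t = 1 := fun t ht => by
    have : 2 ≤ t / s := by rwa [le_div_iff₀ hs]
    rw [hk]
    simp only
    rw [min_eq_left (by linarith), max_eq_right zero_le_one]
  set h : ℝ → ℝ := fun t => ∫ x in (0 : ℝ)..t, k x with hh
  have hderiv : ∀ t, HasDerivAt h (k t) t := fun t =>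
    hkc.integral_hasStrictDerivAt 0 t |>.hasDerivAt
  have hd : deriv h = k := funext fun t => (hderiv t).deriv
  have hzero : ∀ t ≤ s, h t = 0 := by
    intro t ht
    refine intervalIntegral.integral_zero_ae (Eventually.of_forall fun x hx => hks x ?_)
    exact hx.2.trans (max_le hs.le ht)
  have hnn : ∀ t, 0 ≤ h t := by
    intro t
    rcases le_total t s with hts | hts
    · exact (hzero t hts).ge
    · exact intervalIntegral.integral_nonneg (hs.le.trans hts) fun x _ => hk0 x
  refine ⟨h, ?_, hzero, ?_, ?_, hnn, ?_⟩
  · rw [contDiff_one_iff_deriv]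
    exact ⟨fun t => (hderiv t).differentiableAt, hd ▸ hkc⟩
  · exact fun t ht => hd ▸ hks t ht
  · intro t
    rw [hd, Real.norm_of_nonneg (hk0 t)]
    exact hk1 t
  · intro t
    rcases le_total t (2 * s) with hts | hts
    · linarith [hnn t]
    · have h1 : h t = h (2 * s) + ∫ x in (2 * s)..t, k x :=
        (intervalIntegral.integral_add_adjacent_intervals (hkc.intervalIntegrable _ _)
          (hkc.intervalIntegrable _ _)).symm
      have h2 : ∫ x in (2 * s)..t, k x = t - 2 * s := by
        rw [intervalIntegral.integral_congr (g := fun _ => (1 : ℝ))]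
        · simp
        · intro x hx
          rw [uIcc_of_le hts] at hx
          exact hk2s x hx.1
      linarith [hnn (2 * s)]

section Sobolev

variable {n : ℕ} {φ : EuclideanSpace ℝ (Fin n) → ℝ}
  {g : EuclideanSpace ℝ (Fin n) → EuclideanSpace ℝ (Fin n)}

/-- Passage from mollified functions to `φ` under a fixed cutoff `χ`. The hypothesis `hC` is the
Sobolev inequality for smooth functions. The threshold `h` acts above `2 * s`, while the bound
involves `{φ ≥ s}`: the gap absorbs the error of mollification. -/
theorem HasWeakGradient.eLpNorm_comp_cutoff_le {r q ν s D : ℝ} {C : ℝ≥0} (hr : 1 ≤ r)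
    (hν : 0 ≤ ν) (hs : 0 < s) (hD : 0 ≤ D)
    (hC : ∀ u : EuclideanSpace ℝ (Fin n) → ℝ, ContDiff ℝ 1 u → HasCompactSupport u →
      ∀ S : Set (EuclideanSpace ℝ (Fin n)), (∀ x ∉ S, u x = 0) → (∀ x ∉ S, fderiv ℝ u x = 0) →
        eLpNorm u (ENNReal.ofReal q) volume ≤
          C * volume S ^ ν * eLpNorm (fderiv ℝ u) (ENNReal.ofReal r) volume)
    (hφg : HasWeakGradient φ g) (hφ : MemLp φ (ENNReal.ofReal r) volume)
    (hg : MemLp g (ENNReal.ofReal r) volume) {χ : EuclideanSpace ℝ (Fin n) → ℝ}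
    (hχ : ContDiff ℝ 1 χ) (hχc : HasCompactSupport χ) (hχ0 : ∀ x, 0 ≤ χ x) (hχ1 : ∀ x, χ x ≤ 1)
    (hχD : ∀ x, ‖fderiv ℝ χ x‖ ≤ D) {h : ℝ → ℝ} (hh : ContDiff ℝ 1 h)
    (hh0 : ∀ t ≤ 2 * s, h t = 0) (hhd0 : ∀ t ≤ 2 * s, deriv h t = 0) (hhd : ∀ t, ‖deriv h t‖ ≤ 1) :
    eLpNorm (fun x => h (χ x * φ x)) (ENNReal.ofReal q) volume ≤
      C * volume {x | s ≤ φ x} ^ ν * (eLpNorm g (ENNReal.ofReal r) volume +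
        ENNReal.ofReal D * eLpNorm φ (ENNReal.ofReal r) volume) := by
  have hr' : 1 ≤ ENNReal.ofReal r := by simpa using hr
  let ρ : ℕ → ContDiffBump (0 : EuclideanSpace ℝ (Fin n)) := fun k =>
    ⟨1 / ((k : ℝ) + 1) / 2, 1 / ((k : ℝ) + 1), by positivity, half_lt_self (by positivity)⟩
  let u : ℕ → EuclideanSpace ℝ (Fin n) → ℝ := fun k =>
    (ρ k).normed volume ⋆[ContinuousLinearMap.lsmul ℝ ℝ, volume] φ
  have hu : ∀ k, ContDiff ℝ 1 (u k) := fun k => contDiff_normed_convolution (ρ k) hφg.1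
  have hud : ∀ k x, HasFDerivAt (u k) (fderiv ℝ (u k) x) x := fun k x =>
    ((hu k).differentiable one_ne_zero x).hasFDerivAt
  have hae : ∀ᵐ x, Tendsto (fun k => u k x) atTop (𝓝 (φ x)) := by
    refine ContDiffBump.ae_convolution_tendsto_right_of_locallyIntegrable (K := 2)
      tendsto_one_div_add_atTop_nhds_zero_nat (Eventually.of_forall fun k => ?_) hφg.1
    change 1 / ((k : ℝ) + 1) ≤ 2 * (1 / ((k : ℝ) + 1) / 2)
    linarith
  let v : ℕ → EuclideanSpace ℝ (Fin n) → ℝ := fun k x => χ x * u k x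
  have hv : ∀ k, ContDiff ℝ 1 (v k) := fun k => hχ.mul (hu k)
  have hvlim : ∀ᵐ x, Tendsto (fun k => v k x) atTop (𝓝 (χ x * φ x)) := by
    filter_upwards [hae] with x hx using hx.const_mul _
  have hvnorm : ∀ k x, ‖fderiv ℝ (v k) x‖ ≤ ‖fderiv ℝ (u k) x‖ + D * ‖u k x‖ := by
    intro k x
    have h1 : fderiv ℝ (v k) x = χ x • fderiv ℝ (u k) x + u k x • fderiv ℝ χ x :=
      ((hχ.differentiable one_ne_zero x).hasFDerivAt.mul (hud k x)).fderiv
    rw [h1]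
    refine (norm_add_le _ _).trans ?_
    rw [norm_smul, norm_smul, Real.norm_of_nonneg (hχ0 x), mul_comm D]
    gcongr
    · exact mul_le_of_le_one_left (norm_nonneg _) (hχ1 x)
    · exact hχD x
  let w : ℕ → EuclideanSpace ℝ (Fin n) → ℝ := fun k x => h (v k x)
  have hw : ∀ k, ContDiff ℝ 1 (w k) := fun k => hh.comp (hv k)
  have hwd : ∀ k x, fderiv ℝ (w k) x = deriv h (v k x) • fderiv ℝ (v k) x := fun k x =>
    ((hh.differentiable one_ne_zero (v k x)).hasDerivAt.comp_hasFDerivAt x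
      ((hv k).differentiable one_ne_zero x).hasFDerivAt).fderiv
  have hwc : ∀ k, HasCompactSupport (w k) := fun k =>
    (hχc.mul_right (f' := u k)).comp_left (hh0 0 (by positivity))
  have hwnorm : ∀ k, eLpNorm (fderiv ℝ (w k)) (ENNReal.ofReal r) volume ≤
      eLpNorm g (ENNReal.ofReal r) volume +
        ENNReal.ofReal D * eLpNorm φ (ENNReal.ofReal r) volume := by
    intro k
    have h1 : eLpNorm (fderiv ℝ (w k)) (ENNReal.ofReal r) volume ≤
        eLpNorm ((fun x => ‖fderiv ℝ (u k) x‖) + D • fun x => ‖u k x‖)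
          (ENNReal.ofReal r) volume := by
      refine eLpNorm_mono_real fun x => ?_
      rw [hwd, norm_smul]
      exact (mul_le_of_le_one_left (norm_nonneg _) (hhd _)).trans (hvnorm k x)
    refine h1.trans ((eLpNorm_add_le
      ((hu k).continuous_fderiv one_ne_zero).norm.aestronglyMeasurable
      ((hu k).continuous.norm.aestronglyMeasurable.const_smul D) hr').trans ?_)
    rw [eLpNorm_const_smul, Real.enorm_of_nonneg hD, eLpNorm_norm, eLpNorm_norm]
    gcongr
    · have h2 : eLpNorm (fderiv ℝ (u k)) (ENNReal.ofReal r) volume = eLpNorm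
          ((ρ k).normed volume ⋆[ContinuousLinearMap.lsmul ℝ ℝ, volume] g)
          (ENNReal.ofReal r) volume := by
        refine eLpNorm_congr_norm_ae (Eventually.of_forall fun x => ?_)
        rw [hφg.fderiv_normed_convolution (ρ k) x, innerSL_apply_norm]
      rw [h2]
      exact eLpNorm_normed_convolution_le (ρ k) hg.1 hr
    · exact eLpNorm_normed_convolution_le (ρ k) hφ.1 hr
  set B := eLpNorm g (ENNReal.ofReal r) volume +
    ENNReal.ofReal D * eLpNorm φ (ENNReal.ofReal r) volume
  have hBtop : B ≠ ⊤ :=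
    ENNReal.add_ne_top.2 ⟨hg.2.ne, ENNReal.mul_ne_top ENNReal.ofReal_ne_top hφ.2.ne⟩
  -- Convergence in measure on the compact support of the cutoff controls `{v k > 2 * s}`.
  have : IsFiniteMeasure (volume.restrict (tsupport χ)) :=
    ⟨by rw [Measure.restrict_apply_univ]; exact hχc.isCompact.measure_lt_top⟩
  have hmeas := tendstoInMeasure_iff_norm.1 (tendstoInMeasure_of_tendsto_ae
    (μ := volume.restrict (tsupport χ)) (fun k => (hv k).continuous.aestronglyMeasurable)
    (ae_restrict_of_ae hvlim)) s hs
  set T : ℕ → ℝ≥0∞ := fun k =>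
    volume.restrict (tsupport χ) {x | s ≤ ‖v k x - χ x * φ x‖}
  have hset : ∀ k, volume {x | 2 * s < v k x} ≤ volume {x | s ≤ φ x} + T k := by
    intro k
    have hsub : {x | 2 * s < v k x} ⊆
        {x | s ≤ φ x} ∪ ({x | s ≤ ‖v k x - χ x * φ x‖} ∩ tsupport χ) := by
      intro x hx
      rw [mem_ofPred_eq] at hx
      by_cases hxT : s ≤ ‖v k x - χ x * φ x‖
      · refine Or.inr ⟨hxT, subset_tsupport _ fun h0 => ?_⟩
        have : v k x = 0 := by simp [v, h0]
        linarith
      · refine Or.inl ?_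
        rw [mem_ofPred_eq]
        have h1 := (le_abs_self _).trans_lt (not_le.1 hxT)
        have h2 : s < χ x * φ x := by linarith
        have h3 : 0 < φ x := by
          by_contra hneg
          nlinarith [hχ0 x]
        nlinarith [hχ1 x]
    refine (measure_mono hsub).trans ((measure_union_le _ _).trans ?_)
    gcongr
    exact Measure.le_restrict_apply _ _
  have hbound : ∀ k, eLpNorm (w k) (ENNReal.ofReal q) volume ≤
      C * (volume {x | s ≤ φ x} + T k) ^ ν * B := by
    intro k
    have h1 : ∀ x ∉ {x | 2 * s < v k x}, v k x ≤ 2 * s := fun x hx => not_lt.1 hx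
    refine (hC (w k) (hw k) (hwc k) {x | 2 * s < v k x} (fun x hx => hh0 _ (h1 x hx))
      (fun x hx => by rw [hwd, hhd0 _ (h1 x hx), zero_smul])).trans ?_
    gcongr
    · exact hset k
    · exact hwnorm k
  have hlim : Tendsto (fun k => C * (volume {x | s ≤ φ x} + T k) ^ ν * B) atTop
      (𝓝 (C * volume {x | s ≤ φ x} ^ ν * B)) := by
    refine ENNReal.Tendsto.mul_const (ENNReal.Tendsto.const_mul ?_ (Or.inr ENNReal.coe_ne_top))
      (Or.inr hBtop)
    refine ((ENNReal.continuous_rpow_const.tendsto _).comp ?_)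
    simpa using (tendsto_const_nhds (x := volume {x | s ≤ φ x})).add hmeas
  refine (Lp.eLpNorm_lim_le_liminf_eLpNorm (f := w)
    (fun k => (hw k).continuous.aestronglyMeasurable) _ ?_).trans ?_
  · filter_upwards [hvlim] with x hx using (hh.continuous.tendsto _).comp hx
  · exact (liminf_le_liminf (Eventually.of_forall hbound)).trans hlim.liminf_eq.le

/-- Sobolev inequality for the part of a `W^{1,r}` function above a level; the cutoff of
`HasWeakGradient.eLpNorm_comp_cutoff_le` is sent to `1`. -/
theorem exists_eLpNorm_comp_le_measure_rpow_mul (hn : 1 ≤ n) {r q ν : ℝ} (hr : 1 ≤ r)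
    (hq : 0 < q) (hqr : r < n → q < r * n / (n - r)) (hν : ν = 1 / q - (n - r) / (r * n))
    (hν0 : 0 ≤ ν) :
    ∃ C : ℝ≥0, ∀ (φ : EuclideanSpace ℝ (Fin n) → ℝ)
      (g : EuclideanSpace ℝ (Fin n) → EuclideanSpace ℝ (Fin n)), HasWeakGradient φ g →
      MemLp φ (ENNReal.ofReal r) volume → MemLp g (ENNReal.ofReal r) volume →
      ∀ s : ℝ, 0 < s → ∀ h : ℝ → ℝ, ContDiff ℝ 1 h → (∀ t ≤ 2 * s, h t = 0) →
      (∀ t ≤ 2 * s, deriv h t = 0) → (∀ t, ‖deriv h t‖ ≤ 1) →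
        eLpNorm (fun x => h (φ x)) (ENNReal.ofReal q) volume ≤
          C * volume {x | s ≤ φ x} ^ ν * eLpNorm g (ENNReal.ofReal r) volume := by
  obtain ⟨C, hC⟩ := eLpNorm_le_measure_rpow_mul_eLpNorm_fderiv hn hr hq hqr hν
  refine ⟨C, fun φ g hφg hφ hg s hs h hh hh0 hhd0 hhd => ?_⟩
  let b : ContDiffBump (0 : EuclideanSpace ℝ (Fin n)) := ⟨1, 2, one_pos, one_lt_two⟩
  have hb : ContDiff ℝ 1 b := b.contDiff
  obtain ⟨D, hD⟩ := (hb.continuous_fderiv one_ne_zero).bounded_above_of_compact_support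
    (b.hasCompactSupport.fderiv ℝ)
  have hD0 : 0 ≤ D := (norm_nonneg _).trans (hD 0)
  have hpos : ∀ k : ℕ, (0 : ℝ) < 1 / ((k : ℝ) + 1) := fun k => by positivity
  have hk : Tendsto (fun k : ℕ => 1 / ((k : ℝ) + 1)) atTop (𝓝 0) :=
    tendsto_one_div_add_atTop_nhds_zero_nat
  -- The cutoffs `x ↦ b (x / (k + 1))` tend to `1`, and their gradients are `O(1 / k)`.
  have hbound : ∀ k : ℕ,
      eLpNorm (fun x => h (b ((1 / ((k : ℝ) + 1)) • x) * φ x)) (ENNReal.ofReal q) volume ≤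
      C * volume {x | s ≤ φ x} ^ ν * (eLpNorm g (ENNReal.ofReal r) volume +
        ENNReal.ofReal (1 / ((k : ℝ) + 1) * D) * eLpNorm φ (ENNReal.ofReal r) volume) := by
    intro k
    refine hφg.eLpNorm_comp_cutoff_le hr hν0 hs (mul_nonneg (hpos k).le hD0) hC hφ hg
      (χ := fun x => b ((1 / ((k : ℝ) + 1)) • x)) (hb.comp (contDiff_const_smul _))
      (b.hasCompactSupport.comp_smul (hpos k).ne') (fun x => b.nonneg) (fun x => b.le_one)
      (fun x => ?_) hh hh0 hhd0 hhd
    have h1 : fderiv ℝ (fun x => b ((1 / ((k : ℝ) + 1)) • x)) x =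
        (fderiv ℝ b ((1 / ((k : ℝ) + 1)) • x)).comp
          ((1 / ((k : ℝ) + 1)) • ContinuousLinearMap.id ℝ (EuclideanSpace ℝ (Fin n))) :=
      ((hb.differentiable one_ne_zero _).hasFDerivAt.comp x
        ((hasFDerivAt_id x).const_smul (1 / ((k : ℝ) + 1)))).fderiv
    rw [h1, ContinuousLinearMap.comp_smul, ContinuousLinearMap.comp_id, norm_smul,
      Real.norm_of_nonneg (hpos k).le]
    exact mul_le_mul_of_nonneg_left (hD _) (hpos k).le
  have hfin : volume {x | s ≤ φ x} ^ ν ≠ ⊤ := by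
    refine ENNReal.rpow_ne_top_of_nonneg hν0 ?_
    have hsub : {x | s ≤ φ x} ⊆ {x | ENNReal.ofReal s ≤ ‖φ x‖ₑ} := fun x hx => by
      rw [mem_ofPred_eq, ← ofReal_norm]
      exact ENNReal.ofReal_le_ofReal (le_trans hx (le_abs_self _))
    refine ((measure_mono hsub).trans_lt ?_).ne
    exact hφ.meas_ge_lt_top' (by simp; linarith) ENNReal.ofReal_ne_top
      (by simpa using hs)
  have hlim : Tendsto (fun k : ℕ => C * volume {x | s ≤ φ x} ^ ν *
      (eLpNorm g (ENNReal.ofReal r) volume +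
        ENNReal.ofReal (1 / ((k : ℝ) + 1) * D) * eLpNorm φ (ENNReal.ofReal r) volume)) atTop
      (𝓝 (C * volume {x | s ≤ φ x} ^ ν * eLpNorm g (ENNReal.ofReal r) volume)) := by
    refine ENNReal.Tendsto.const_mul ?_ (Or.inr (ENNReal.mul_ne_top ENNReal.coe_ne_top hfin))
    have h1 := ENNReal.Tendsto.mul_const (ENNReal.tendsto_ofReal (hk.mul_const D))
      (Or.inr hφ.2.ne)
    simpa using (tendsto_const_nhds (x := eLpNorm g (ENNReal.ofReal r) volume)).add h1
  refine (Lp.eLpNorm_lim_le_liminf_eLpNorm (fun k => ?_) _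
    (Eventually.of_forall fun x => ?_)).trans
    ((liminf_le_liminf (Eventually.of_forall hbound)).trans hlim.liminf_eq.le)
  · exact hh.continuous.comp_aestronglyMeasurable
      ((hb.continuous.comp (continuous_const_smul _)).aestronglyMeasurable.mul hφ.1)
  · have h1 : Tendsto (fun k : ℕ => b ((1 / ((k : ℝ) + 1)) • x)) atTop (𝓝 (b 0)) := by
      refine (hb.continuous.tendsto 0).comp ?_
      simpa using hk.smul_const x
    have h2 : b 0 = 1 := b.one_of_mem_closedBall (by simp [b])
    rw [h2] at h1
    have h3 := (hh.continuous.tendsto _).comp (h1.mul_const (φ x))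
    rwa [one_mul] at h3

end Sobolev

/-! ### Choice of the truncation level -/

lemma rpow_mul_one_add_rpow_le {K ν ε p δ : ℝ} (hK : 0 < K) (hp : 0 ≤ p)
    (hδ : |δ * p| ≤ min ε ν) :
    K ^ ν * (1 + K ^ δ) ^ p ≤ 2 ^ p * (1 + (1 + K ^ ε) * K ^ ν) := by
  have hx : 0 < K ^ δ := Real.rpow_pos_of_pos hK _
  have h1 : (1 + K ^ δ) ^ p ≤ 2 ^ p * (1 + K ^ (δ * p)) := by
    rw [Real.rpow_mul hK.le]
    have hxp : 0 < (K ^ δ) ^ p := Real.rpow_pos_of_pos hx _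
    rcases le_total (K ^ δ) 1 with h | h
    · calc (1 + K ^ δ) ^ p ≤ 2 ^ p := by gcongr; linarith
        _ ≤ _ := le_mul_of_one_le_right (by positivity) (by linarith)
    · calc (1 + K ^ δ) ^ p ≤ (2 * K ^ δ) ^ p := by gcongr; linarith
        _ = 2 ^ p * (K ^ δ) ^ p := Real.mul_rpow zero_le_two hx.le
        _ ≤ _ := by gcongr; linarith
  have hδ1 : -ν ≤ δ * p := by
    linarith [neg_abs_le (δ * p), min_le_right ε ν]
  have hδ2 : δ * p ≤ ε := (le_abs_self _).trans (hδ.trans (min_le_left _ _))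
  have h2 : K ^ ν * K ^ (δ * p) ≤ 1 + K ^ ε * K ^ ν := by
    rw [← Real.rpow_add hK, ← Real.rpow_add hK]
    have h3 : 0 < K ^ (ε + ν) := Real.rpow_pos_of_pos hK _
    rcases le_total K 1 with h | h
    · linarith [Real.rpow_le_one hK.le h (by linarith : 0 ≤ ν + δ * p)]
    · linarith [Real.rpow_le_rpow_of_exponent_le h (by linarith : ν + δ * p ≤ ε + ν)]
  calc K ^ ν * (1 + K ^ δ) ^ p ≤ K ^ ν * (2 ^ p * (1 + K ^ (δ * p))) := by gcongr
    _ = 2 ^ p * (K ^ ν + K ^ ν * K ^ (δ * p)) := by ring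
    _ ≤ 2 ^ p * (K ^ ν + (1 + K ^ ε * K ^ ν)) := by gcongr
    _ = _ := by ring

/-- Powers of `L (G ^ 2)` are negligible against powers of `G` for small `G`. The minimum with `1`
reflects that `L` is comparable to a constant on `[1, ∞)`. -/
lemma ConditionL.exists_min_sq_mul_rpow_le {L : ℝ → ℝ} (hL : ConditionL L) (β : ℝ) :
    ∃ C : ℝ, 0 < C ∧ ∀ G : ℝ, 0 < G → min (G ^ 2) 1 * L (G ^ 2) ^ (-β) ≤ C * G := by
  have hL' := hL
  obtain ⟨-, -, -, -, hpos, ⟨M, hM⟩, hmono, -⟩ := hL'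
  have hL1 := hpos 1 (mem_Ioi.2 one_pos)
  have hM0 : 0 < M := hL1.trans_le (hM 1 (mem_Ioi.2 one_pos))
  have hmin : ∀ G : ℝ, 0 < G → min (G ^ 2) 1 ≤ G := fun G hG => by
    rcases le_total G 1 with h | h
    · exact (min_le_left _ _).trans (by nlinarith)
    · exact (min_le_right _ _).trans h
  rcases le_or_gt β 0 with hβ | hβ
  · refine ⟨M ^ (-β), by positivity, fun G hG => ?_⟩
    rw [mul_comm]
    have h1 : L (G ^ 2) ≤ M := hM _ (by positivity : 0 < G ^ 2)
    have h2 : 0 < L (G ^ 2) := hpos _ (by positivity : 0 < G ^ 2)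
    exact mul_le_mul (Real.rpow_le_rpow h2.le h1 (by linarith)) (hmin G hG) (by positivity)
      (by positivity)
  · obtain ⟨A, hA, hgrow⟩ := hL.le_rpow_mul (α := 1 / (2 * β)) (by positivity)
    have hA0 : 0 < A := by linarith
    refine ⟨(A / L 1) ^ β, by positivity, fun G hG => ?_⟩
    have hG2 : 0 < G ^ 2 := by positivity
    have hLG := hpos _ hG2
    rcases le_total G 1 with h | h
    · have h1 := hgrow (G ^ 2) 1 hG2 (by nlinarith)
      have h2 : (L (G ^ 2))⁻¹ ≤ A / L 1 * (1 / G ^ 2) ^ (1 / (2 * β)) := by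
        rw [inv_le_iff_one_le_mul₀ hLG, div_mul_eq_mul_div, div_mul_eq_mul_div, one_le_div hL1]
        exact h1
      have h3 : ((1 / G ^ 2) ^ (1 / (2 * β))) ^ β = 1 / G := by
        have e : (1 / G ^ 2 : ℝ) = (1 / G) ^ (2 : ℝ) := by
          rw [Real.rpow_two, div_pow, one_pow]
        rw [e, ← Real.rpow_mul (by positivity), ← Real.rpow_mul (by positivity)]
        rw [show (2 : ℝ) * (1 / (2 * β) * β) = 1 by field_simp, Real.rpow_one]
      have h4 : L (G ^ 2) ^ (-β) ≤ (A / L 1) ^ β * (1 / G) := by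
        rw [Real.rpow_neg hLG.le, ← Real.inv_rpow hLG.le, ← h3,
          ← Real.mul_rpow (by positivity) (by positivity)]
        gcongr
      calc min (G ^ 2) 1 * L (G ^ 2) ^ (-β) ≤ G ^ 2 * ((A / L 1) ^ β * (1 / G)) := by
            gcongr
            exact min_le_left _ _
        _ = _ := by field_simp
    · have h1 : L 1 ≤ L (G ^ 2) := hmono (mem_Ioi.2 one_pos) hG2 (by nlinarith)
      have h2 : L (G ^ 2) ^ (-β) ≤ (A / L 1) ^ β := by
        rw [Real.rpow_neg hLG.le, ← Real.inv_rpow hLG.le]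
        gcongr
        rw [inv_le_iff_one_le_mul₀ hLG, div_mul_eq_mul_div, one_le_div hL1]
        nlinarith
      rw [mul_comm]
      exact mul_le_mul h2 (hmin G hG) (by positivity) (by positivity)

/-- The optimal truncation level. Here `κ` is `1 / q`. -/
lemma ConditionL.exists_level {L : ℝ → ℝ} (hL : ConditionL L) {ν κ ε : ℝ} (hν : 0 < ν)
    (hκ : 0 < κ) (hε : 0 < ε) :
    ∃ C : ℝ, 0 < C ∧ ∀ K G : ℝ, 0 < K → 0 < G → ∃ s : ℝ, 0 < s ∧
      (K / L s) ^ ν * G + s * (K / L s) ^ κ ≤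
        C * (1 + (1 + K ^ ε) * K ^ ν) * G * L (G ^ 2) ^ (-ν) := by
  set β : ℝ := κ - ν with hβ
  set α : ℝ := min ε ν / ((|β| + 1) * (ν + κ)) with hα
  have hm : 0 < min ε ν := lt_min hε hν
  have hα0 : 0 < α := by positivity
  have hexp : ∀ p : ℝ, 0 ≤ p → p ≤ ν + κ → |β * α * p| ≤ min ε ν := by
    intro p hp hp'
    rw [abs_mul, abs_mul, abs_of_pos hα0, abs_of_nonneg hp]
    calc |β| * α * p ≤ (|β| + 1) * α * (ν + κ) := by gcongr; linarith
      _ = _ := by rw [hα]; field_simp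
  obtain ⟨A, hA, hgrow⟩ := hL.le_rpow_mul hα0
  obtain ⟨B, hB, hmin⟩ := hL.exists_min_sq_mul_rpow_le β
  obtain ⟨-, -, -, -, hpos, ⟨M, hM⟩, hmono, -⟩ := hL
  have hL1 := hpos 1 (mem_Ioi.2 one_pos)
  have hM1 : 1 ≤ M / L 1 := by rw [one_le_div hL1]; exact hM 1 (mem_Ioi.2 one_pos)
  set N : ℝ := M / L 1 * (1 + A * B ^ α) with hN
  have hN0 : 0 < N := by positivity
  refine ⟨N ^ ν * 2 ^ ν + N ^ κ * 2 ^ κ, by positivity, fun K G hK hG => ?_⟩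
  have hG2 : 0 < G ^ 2 := by positivity
  have hLG := hpos _ hG2
  -- This level balances the two terms, up to replacing `L s` by `L (G ^ 2)`.
  set s : ℝ := G * K ^ (-β) * L (G ^ 2) ^ β with hs
  have hs0 : 0 < s := by positivity
  have hLs := hpos s hs0
  set H : ℝ := min (G ^ 2) 1 with hH
  have hH0 : 0 < H := lt_min hG2 one_pos
  have hLH := hpos H hH0
  have hHs : H / s ≤ B * K ^ β := by
    rw [div_le_iff₀ hs0]
    have h1 := hmin G hG
    rw [Real.rpow_neg hLG.le, ← div_eq_mul_inv, div_le_iff₀ (by positivity)] at h1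
    refine h1.trans (le_of_eq ?_)
    rw [hs, Real.rpow_neg hK.le]
    field_simp
  have hLG_le : L (G ^ 2) ≤ M / L 1 * L H := by
    rcases le_total (G ^ 2) 1 with h | h
    · rw [hH, min_eq_left h]
      exact le_mul_of_one_le_left hLG.le hM1
    · rw [hH, min_eq_right h, div_mul_cancel₀ _ hL1.ne']
      exact hM _ hG2
  have hcomp : L (G ^ 2) ≤ N * (1 + K ^ (β * α)) * L s := by
    have hKβ : 0 < K ^ (β * α) := Real.rpow_pos_of_pos hK _
    have h1 : L H ≤ (1 + A * B ^ α) * (1 + K ^ (β * α)) * L s := by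
      rcases le_total H s with h | h
      · refine (hmono hH0 hs0 h).trans (le_mul_of_one_le_left hLs.le ?_)
        have : 0 ≤ A * B ^ α := by positivity
        nlinarith
      · have h2 : (H / s) ^ α ≤ B ^ α * K ^ (β * α) := by
          rw [Real.rpow_mul hK.le, ← Real.mul_rpow hB.le (by positivity)]
          gcongr
        calc L H ≤ A * (H / s) ^ α * L s := hgrow s H hs0 h
          _ ≤ A * (B ^ α * K ^ (β * α)) * L s := by gcongr
          _ = (A * B ^ α) * K ^ (β * α) * L s := by ring
          _ ≤ _ := by gcongr <;> linarith
    calc L (G ^ 2) ≤ M / L 1 * L H := hLG_le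
      _ ≤ M / L 1 * ((1 + A * B ^ α) * (1 + K ^ (β * α)) * L s) := by gcongr
      _ = _ := by rw [hN]; ring
  have hKL : K / L s ≤ N * K * (1 + K ^ (β * α)) / L (G ^ 2) := by
    rw [div_le_div_iff₀ hLs hLG]
    nlinarith
  have hpow : ∀ p : ℝ, 0 ≤ p → p ≤ ν + κ → (K / L s) ^ p ≤
      N ^ p * 2 ^ p * (1 + (1 + K ^ ε) * K ^ ν) * K ^ (p - ν) * L (G ^ 2) ^ (-p) := by
    intro p hp hp'
    calc (K / L s) ^ p ≤ (N * K * (1 + K ^ (β * α)) / L (G ^ 2)) ^ p := by gcongr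
      _ = N ^ p * (K ^ ν * (1 + K ^ (β * α)) ^ p) * K ^ (p - ν) * L (G ^ 2) ^ (-p) := by
        rw [Real.div_rpow (by positivity) hLG.le, Real.mul_rpow (by positivity) (by positivity),
          Real.mul_rpow hN0.le hK.le, Real.rpow_neg hLG.le, div_eq_mul_inv,
          show K ^ p = K ^ ν * K ^ (p - ν) by rw [← Real.rpow_add hK]; ring_nf]
        ring
      _ ≤ N ^ p * (2 ^ p * (1 + (1 + K ^ ε) * K ^ ν)) * K ^ (p - ν) * L (G ^ 2) ^ (-p) := by
        gcongr N ^ p * ?_ * _ * _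
        exact rpow_mul_one_add_rpow_le hK hp (hexp p hp hp')
      _ = _ := by ring
  refine ⟨s, hs0, ?_⟩
  have t1 := mul_le_mul_of_nonneg_right (hpow ν hν.le (by linarith)) hG.le
  have t2 := mul_le_mul_of_nonneg_left (hpow κ hκ.le (by linarith)) hs0.le
  rw [sub_self, Real.rpow_zero, mul_one] at t1
  have e2 : s * (N ^ κ * 2 ^ κ * (1 + (1 + K ^ ε) * K ^ ν) * K ^ (κ - ν) * L (G ^ 2) ^ (-κ)) =
      N ^ κ * 2 ^ κ * (1 + (1 + K ^ ε) * K ^ ν) * G * L (G ^ 2) ^ (-ν) := by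
    rw [hs, show -ν = β + -κ by rw [hβ]; ring, Real.rpow_add hLG, ← hβ, Real.rpow_neg hK.le]
    field_simp
  rw [e2] at t2
  refine (add_le_add t1 t2).trans (le_of_eq ?_)
  ring

/-! ### The parts of `φ` above and below the level -/

section

variable {α : Type*} [MeasurableSpace α] {μ : Measure α} {L : ℝ → ℝ} {φ : α → ℝ}

lemma ConditionL.nonneg (hL : ConditionL L) {t : ℝ} (ht : 0 ≤ t) : 0 ≤ L t := by
  obtain ⟨-, -, hcont, -, hpos, -⟩ := hL
  rcases ht.eq_or_lt with rfl | ht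
  · have h1 : Tendsto L (𝓝[>] 0) (𝓝 (L 0)) :=
      (hcont 0 self_mem_Ici).mono_left (nhdsWithin_mono _ Ioi_subset_Ici_self)
    exact ge_of_tendsto h1 (eventually_mem_nhdsWithin.mono fun t ht => (hpos t ht).le)
  · exact (hpos t ht).le

/-- Markov's inequality for `L ∘ φ`. -/
lemma ConditionL.measure_le (hL : ConditionL L) (hφ0 : ∀ᵐ x ∂μ, 0 ≤ φ x)
    (hint : Integrable (fun x => L (φ x)) μ) {s : ℝ} (hs : 0 < s) :
    μ {x | s ≤ φ x} ≤ ENNReal.ofReal ((∫ x, L (φ x) ∂μ) / L s) := by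
  have hnn : 0 ≤ᵐ[μ] fun x => L (φ x) := hφ0.mono fun x hx => hL.nonneg hx
  obtain ⟨-, -, -, -, hpos, -, hmono, -⟩ := hL
  have hLs := hpos s hs
  rw [ENNReal.ofReal_div_of_pos hLs, ofReal_integral_eq_lintegral_ofReal hint hnn]
  have hsub : {x | s ≤ φ x} ⊆ {x | ENNReal.ofReal (L s) ≤ ENNReal.ofReal (L (φ x))} :=
    fun x hx => ENNReal.ofReal_le_ofReal (hmono hs (hs.trans_le hx) hx)
  exact (measure_mono hsub).trans (meas_ge_le_lintegral_div hint.1.aemeasurable.ennreal_ofReal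
    (by simpa using hLs) ENNReal.ofReal_ne_top)

lemma ConditionL.exists_eLpNorm_min_le (hL : ConditionL L) {q : ℝ} (hq : 0 < q) :
    ∃ A : ℝ, 0 < A ∧ ∀ (φ : α → ℝ), (∀ᵐ x ∂μ, 0 ≤ φ x) →
      Integrable (fun x => L (φ x)) μ → ∀ s : ℝ, 0 < s →
        eLpNorm (fun x => min (φ x) (4 * s)) (ENNReal.ofReal q) μ ≤
          ENNReal.ofReal (A * (s * ((∫ x, L (φ x) ∂μ) / L s) ^ (1 / q))) := by
  obtain ⟨B, hB, hgrow⟩ := hL.le_rpow_mul hq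
  have hB0 : 0 < B := by linarith
  refine ⟨B ^ (1 / q) * 4, by positivity, fun φ hφ0 hint s hs => ?_⟩
  have hnn : 0 ≤ᵐ[μ] fun x => L (φ x) := hφ0.mono fun x hx => hL.nonneg hx
  have hK : 0 ≤ ∫ x, L (φ x) ∂μ := integral_nonneg_of_ae hnn
  have hL' := hL
  obtain ⟨-, -, -, -, hpos, -, hmono, -⟩ := hL'
  have hLs := hpos s hs
  have h4s : 0 < 4 * s := by positivity
  have hL4s := hpos _ h4s
  have hL4 : L s ≤ L (4 * s) := hmono hs h4s (by linarith)
  set c : ℝ := B * (4 * s) ^ q / L s with hc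
  have hc0 : 0 ≤ c := by positivity
  have hpt : ∀ᵐ x ∂μ, ‖min (φ x) (4 * s)‖ₑ ^ q ≤ ENNReal.ofReal (c * L (φ x)) := by
    filter_upwards [hφ0] with x hx
    have hm0 : 0 ≤ min (φ x) (4 * s) := le_min hx h4s.le
    rw [Real.enorm_of_nonneg hm0, ENNReal.ofReal_rpow_of_nonneg hm0 hq.le]
    apply ENNReal.ofReal_le_ofReal
    rcases hx.eq_or_lt with h0 | hpx
    · rw [← h0, min_eq_left h4s.le, Real.zero_rpow hq.ne']
      exact mul_nonneg hc0 (hL.nonneg le_rfl)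
    · set m := min (φ x) (4 * s) with hm
      have hmp : 0 < m := lt_min hpx h4s
      have hLm := hpos m hmp
      have h1 := hgrow m (4 * s) hmp (min_le_right _ _)
      rw [Real.div_rpow h4s.le hmp.le, mul_div_assoc', div_mul_eq_mul_div,
        le_div_iff₀ (by positivity)] at h1
      have h2 : L m ≤ L (φ x) := hmono hmp hpx (min_le_left _ _)
      rw [hc, div_mul_eq_mul_div, le_div_iff₀ hLs]
      calc m ^ q * L s ≤ L (4 * s) * m ^ q := by rw [mul_comm]; gcongr
        _ ≤ B * (4 * s) ^ q * L m := h1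
        _ ≤ _ := by gcongr
  rw [eLpNorm_eq_lintegral_rpow_enorm_toReal (by simpa using hq) ENNReal.ofReal_ne_top,
    ENNReal.toReal_ofReal hq.le]
  have hcK : ∫⁻ x, ENNReal.ofReal (c * L (φ x)) ∂μ =
      ENNReal.ofReal (c * ∫ x, L (φ x) ∂μ) := by
    rw [← integral_const_mul, ofReal_integral_eq_lintegral_ofReal (hint.const_mul c)
      (hnn.mono fun x hx => mul_nonneg hc0 hx)]
  refine (ENNReal.rpow_le_rpow (lintegral_mono_ae hpt) (by positivity)).trans ?_
  rw [hcK, ENNReal.ofReal_rpow_of_nonneg (mul_nonneg hc0 hK) (by positivity)]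
  refine ENNReal.ofReal_le_ofReal (le_of_eq ?_)
  rw [hc, show B * (4 * s) ^ q / L s * (∫ x, L (φ x) ∂μ) =
      B * ((4 * s) ^ q * ((∫ x, L (φ x) ∂μ) / L s)) by ring,
    Real.mul_rpow hB0.le (by positivity), Real.mul_rpow (by positivity) (by positivity),
    ← Real.rpow_mul h4s.le, mul_one_div_cancel hq.ne', Real.rpow_one]
  ring

end

theorem theorem1p2 (L : ℝ → ℝ) (hL : ConditionL L) (n : ℕ) (hn : 1 ≤ n)
    (r : ℝ) (hr : 1 ≤ r) (q : ℝ) (hq : 0 < q)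
    (hqr : r < n → q < r * n / (n - r))
    (ν : ℝ) (hν : ν = 1 / q - (n - r) / (r * n)) (ε : ℝ) (hε : 0 < ε) :
    ∃ C : ℝ, 0 < C ∧
      ∀ φ : EuclideanSpace ℝ (Fin n) → ℝ,
        MemW1 r φ → ¬ (φ =ᵐ[volume] 0) → (∀ᵐ x ∂volume, 0 ≤ φ x) →
        ∀ K : ℝ, Integrable (fun x => L (φ x)) volume → K = ∫ x, L (φ x) →
        ∀ g : EuclideanSpace ℝ (Fin n) → EuclideanSpace ℝ (Fin n), HasWeakGradient φ g →
        ∀ G : ℝ, G = (eLpNorm g (ENNReal.ofReal r) volume).toReal →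
          eLpNorm φ (ENNReal.ofReal q) volume ≤
            ENNReal.ofReal (C * (1 + (1 + K ^ ε) * K ^ ν) * G * (L (G ^ 2)) ^ (-ν)) := by
  have hr0 : 0 < r := by linarith
  have hn0 : (0 : ℝ) < n := by exact_mod_cast hn
  have hν0 : 0 < ν := by
    rw [hν, sub_pos]
    rcases lt_or_ge r n with h | h
    · have h1 := hqr h
      rw [lt_div_iff₀ (by linarith)] at h1
      rw [div_lt_div_iff₀ (by positivity) hq]
      linarith
    · exact (div_nonpos_of_nonpos_of_nonneg (by linarith) (by positivity)).trans_lt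
        (by positivity)
  obtain ⟨C₀, hsob⟩ := exists_eLpNorm_comp_le_measure_rpow_mul hn hr hq hqr hν hν0.le
  obtain ⟨A, hA, hmin⟩ := hL.exists_eLpNorm_min_le
    (μ := (volume : Measure (EuclideanSpace ℝ (Fin n)))) hq
  obtain ⟨C₁, hC₁, hlevel⟩ := hL.exists_level hν0 (one_div_pos.2 hq) hε
  set a : ℝ := (ENNReal.LpAddConst (ENNReal.ofReal q)).toReal with ha
  have haq : ENNReal.LpAddConst (ENNReal.ofReal q) = ENNReal.ofReal a :=
    (ENNReal.ofReal_toReal (ENNReal.LpAddConst_lt_top _).ne).symm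
  have ha0 : 0 ≤ a := ENNReal.toReal_nonneg
  refine ⟨(a * (C₀ + A) + 1) * C₁, by positivity, ?_⟩
  intro φ ⟨hφ, g', hg', hg'r⟩ hne hφ0 K hint hKeq g hg G hG
  -- Weak gradients are unique, so `g` lies in `L^r` and `G` is its norm, not the `toReal` of `∞`.
  have hgr : MemLp g (ENNReal.ofReal r) volume := hg'r.ae_eq (hg'.ae_eq hg)
  have hGe : eLpNorm g (ENNReal.ofReal r) volume = ENNReal.ofReal G := by
    rw [hG, ENNReal.ofReal_toReal hgr.2.ne]
  have hG0 : 0 ≤ G := hG ▸ ENNReal.toReal_nonneg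
  have hpos : ∀ s ∈ Ioi (0 : ℝ), 0 < L s := by
    obtain ⟨-, -, -, -, hpos, -⟩ := hL
    exact hpos
  have hmeas := fun s hs => hL.measure_le (s := s) hφ0 hint hs
  rw [← hKeq] at hmeas
  have hK0 : 0 ≤ K := hKeq ▸ integral_nonneg_of_ae (hφ0.mono fun x hx => hL.nonneg hx)
  -- The part of `φ` above the level `4 * s`.
  have hupper : ∀ s : ℝ, 0 < s → ∃ h : ℝ → ℝ, ContDiff ℝ 1 h ∧ (∀ t, 0 ≤ h t) ∧
      (∀ t, t - 4 * s ≤ h t) ∧ eLpNorm (fun x => h (φ x)) (ENNReal.ofReal q) volume ≤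
        ENNReal.ofReal (C₀ * ((K / L s) ^ ν * G)) := by
    intro s hs
    obtain ⟨h, hh, hh0, hhd0, hhd, hhnn, hhge⟩ :=
      exists_contDiff_soft_threshold (s := 2 * s) (by positivity)
    refine ⟨h, hh, hhnn, fun t => by linarith [hhge t], ?_⟩
    have hKL : 0 ≤ K / L s := div_nonneg hK0 (hpos s hs).le
    refine (hsob φ g hg hφ hgr s hs h hh hh0 hhd0 hhd).trans ?_
    rw [hGe, ENNReal.ofReal_mul (NNReal.coe_nonneg C₀), ENNReal.ofReal_mul (by positivity),
      ← ENNReal.ofReal_rpow_of_nonneg hKL hν0.le, ENNReal.ofReal_coe_nnreal, mul_assoc]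
    gcongr
    exact hmeas s hs
  -- If `K = 0` or `G = 0`, then `φ ≤ 4 * s` for every `s > 0`, so `φ = 0`.
  have hKG : 0 < K * G := by
    refine (mul_nonneg hK0 hG0).lt_of_ne fun h0 => hne ?_
    have hle : ∀ s : ℝ, 0 < s → ∀ᵐ x, φ x ≤ 4 * s := by
      intro s hs
      obtain ⟨h, hh, -, hge, hle⟩ := hupper s hs
      have hz : (K / L s) ^ ν * G = 0 := by
        rcases mul_eq_zero.1 h0.symm with hz | hz
        · rw [hz, zero_div, Real.zero_rpow hν0.ne', zero_mul]
        · rw [hz, mul_zero]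
      rw [hz, mul_zero, ENNReal.ofReal_zero, nonpos_iff_eq_zero, eLpNorm_eq_zero_iff
        (hh.continuous.comp_aestronglyMeasurable hφ.1) (by simpa using hq)] at hle
      filter_upwards [hle] with x hx
      have h1 := hge (φ x)
      have h2 : h (φ x) = 0 := hx
      linarith
    have hall : ∀ᵐ x, ∀ k : ℕ, φ x ≤ 4 * (1 / ((k : ℝ) + 1)) :=
      ae_all_iff.2 fun k => hle _ (by positivity)
    filter_upwards [hall, hφ0] with x hx hx0
    refine le_antisymm ?_ hx0
    have h1 := (tendsto_one_div_add_atTop_nhds_zero_nat (𝕜 := ℝ)).const_mul 4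
    rw [mul_zero] at h1
    exact ge_of_tendsto' h1 hx
  have hKpos : 0 < K := pos_of_mul_pos_left hKG hG0
  have hGpos : 0 < G := pos_of_mul_pos_right hKG hK0
  obtain ⟨s, hs, hbound⟩ := hlevel K G hKpos hGpos
  obtain ⟨h, hh, hhnn, hge, hle⟩ := hupper s hs
  have hlow := hmin φ hφ0 hint s hs
  rw [← hKeq] at hlow
  have hLs := hpos s hs
  have hLG := hpos _ (mem_Ioi.2 (by positivity : 0 < G ^ 2))
  have hsplit : eLpNorm φ (ENNReal.ofReal q) volume ≤
      eLpNorm ((fun x => h (φ x)) + fun x => min (φ x) (4 * s)) (ENNReal.ofReal q) volume := by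
    refine eLpNorm_mono_ae (hφ0.mono fun x hx => ?_)
    have h0 : φ x ≤ h (φ x) + min (φ x) (4 * s) := by
      rcases le_total (φ x) (4 * s) with hc | hc
      · rw [min_eq_left hc]; linarith [hhnn (φ x)]
      · rw [min_eq_right hc]; linarith [hge (φ x)]
    rw [Real.norm_of_nonneg hx]
    exact h0.trans (le_abs_self _)
  calc eLpNorm φ (ENNReal.ofReal q) volume
      ≤ ENNReal.ofReal a * (ENNReal.ofReal (C₀ * ((K / L s) ^ ν * G)) +
          ENNReal.ofReal (A * (s * (K / L s) ^ (1 / q)))) := by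
        refine hsplit.trans ((eLpNorm_add_le' (hh.continuous.comp_aestronglyMeasurable hφ.1)
          (hφ.1.inf aestronglyMeasurable_const) _).trans ?_)
        rw [haq]
        gcongr
        exact hlow
    _ = ENNReal.ofReal (a * (C₀ * ((K / L s) ^ ν * G) + A * (s * (K / L s) ^ (1 / q)))) := by
        rw [ENNReal.ofReal_mul ha0, ENNReal.ofReal_add (by positivity) (by positivity)]
    _ ≤ _ := by
        apply ENNReal.ofReal_le_ofReal
        set X := (K / L s) ^ ν * G
        set Y := s * (K / L s) ^ (1 / q)
        have hX : 0 ≤ X := by positivity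
        have hY : 0 ≤ Y := by positivity
        have hC₀ : (0 : ℝ) ≤ C₀ := NNReal.coe_nonneg C₀
        calc a * (C₀ * X + A * Y) ≤ (a * (C₀ + A) + 1) * (X + Y) := by
              nlinarith [mul_nonneg ha0 (mul_nonneg hC₀ hY), mul_nonneg ha0 (mul_nonneg hA.le hX)]
          _ ≤ (a * (C₀ + A) + 1) * (C₁ * (1 + (1 + K ^ ε) * K ^ ν) * G * L (G ^ 2) ^ (-ν)) := by
              gcongr
          _ = _ := by ring
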